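/- Conventions. All graphs are finite, directed and simple: no loops and no multiple edges, but both $u\to v$ and $v\to u$ may be edges. A graph is *irreducible* if there is a directed path from $u$ to $v$ for all vertices $u,v$, and *essential* if every vertex has in-degree and out-degree at least $1$. A *set-equipped graph* $(G,\mathcal S)$ is a graph $G$ with a family $\mathcal S=(S_v)_{v\in V(G)}$ of nonempty sets of positive integers. Its *$\mathcal S$-graph shift* $X(G,\mathcal S)\subseteq V(G)^{\mathbb Z}$ is the closure (product topology, $V(G)$ discrete) of the set of all bi-infinite strings $$\cdots u_{-1}^{n_{-1}}u_0^{n_0}u_1^{n_1}\cdots,\qquad u_i\in V(G),\ n_i\in S_{u_i},\ (u_i,u_{i+1})\in E(G)\ \text{ for all } i\in\mathbb Z,$$ where the origin of $\mathbb Z$ may lie at any place of the string. Set-equipped graphs are assumed to be essential, so that every letter of the alphabet $V(G)$ occurs in $X(G,\mathcal S)$; an *$\mathcal S$-graph shift on $q$ letters* is a shift $X(H,\mathcal T)$, where $(H,\mathcal T)$ is a set-equipped graph, $H$ is essential and $H$ has exactly $q$ vertices. Two shifts are *conjugate* if there is a homeomorphism between them that commutes with the shift maps. **Proposition.** Let $p$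 and $q$ be positive integers with $q>p$ and let $(G,\mathcal S)$ be a set-equipped graph on $p$ vertices with $G$ essential and irreducible. 1. If $G$ is a directed cycle through all of its vertices, every $S_v$ is a singleton $\{s_v\}$, and $\sum_{v\in V(G)} s_v<q$, then no $\mathcal S$-graph shift on $q$ letters is conjugate to $X(G,\mathcal S)$. 2. In every other case, there is an $\mathcal S$-graph shift on $q$ letters that is conjugate to $X(G,\mathcal S)$. -/

import Mathlib

open SymbolicDynamics.FullShift

/-- A set-equipped graph on the vertex set `V`: a simple directed graph (no loops; multiple edges
are impossible, opposite edges `u → v`, `v → u` are allowed) together with a nonempty set `S v` of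
positive integers at each vertex `v`. -/
structure SetEquippedGraph (V : Type*) where
  graph : Digraph V
  loopless : ∀ v, ¬ graph.Adj v v
  S : V → Set ℕ
  nonempty : ∀ v, (S v).Nonempty
  pos : ∀ v, ∀ n ∈ S v, 0 < n

/-- There is a directed path from every vertex to every vertex. -/
def Digraph.IsIrreducible {V : Type*} (G : Digraph V) : Prop :=
  ∀ u v, Relation.ReflTransGen G.Adj u v

/-- Every vertex has in-degree and out-degree at least one. -/
def Digraph.IsEssential {V : Type*} (G : Digraph V) : Prop :=
  ∀ v, (∃ u, G.Adj u v) ∧ ∃ w, G.Adj v w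

/-- `G` is a directed cycle: the edges are exactly `v → c v` for a cyclic permutation `c` of all
the vertices. -/
def Digraph.IsDirectedCycle {V : Type*} (G : Digraph V) : Prop :=
  ∃ c : Equiv.Perm V, c.IsCycleOn Set.univ ∧ ∀ u v, G.Adj u v ↔ c u = v

namespace SetEquippedGraph

variable {V : Type*}

/-- The bi-infinite strings `⋯ u₋₁^{n₋₁} u₀^{n₀} u₁^{n₁} ⋯` with `n i ∈ S (u i)` and
`(u i, u (i + 1))` an edge for all `i`; the `i`-th block occupies the positions
`t i, …, t (i + 1) - 1`, and the origin may lie anywhere. -/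
def blockStrings (𝒢 : SetEquippedGraph V) : Set (ℤ → V) :=
  {x | ∃ (u : ℤ → V) (n : ℤ → ℕ) (t : ℤ → ℤ),
    (∀ i, n i ∈ 𝒢.S (u i)) ∧
    (∀ i, 𝒢.graph.Adj (u i) (u (i + 1))) ∧
    (∀ i, t (i + 1) = t i + n i) ∧
    ∀ i k, t i ≤ k → k < t (i + 1) → x k = u i}

theorem shift_mem_blockStrings (𝒢 : SetEquippedGraph V) (g : ℤ) {x : ℤ → V}
    (hx : x ∈ 𝒢.blockStrings) : shift g x ∈ 𝒢.blockStrings := by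
  obtain ⟨u, n, t, hn, hu, ht, h⟩ := hx
  refine ⟨u, n, fun i => t i - g, hn, hu, fun i => ?_, fun i k h1 h2 => ?_⟩
  · have := ht i
    dsimp only
    omega
  · rw [shift_apply]
    dsimp only at h1 h2
    exact h i _ (by omega) (by omega)

/-- The `𝒮`-graph shift `X(G, 𝒮)`, a subshift over the alphabet `V`. -/
def sgraphShift [TopologicalSpace V] (𝒢 : SetEquippedGraph V) : Subshift V ℤ where
  carrier := closure 𝒢.blockStrings
  isClosed := isClosed_closure
  mapsTo g := Set.MapsTo.closure (fun _ hx => 𝒢.shift_mem_blockStrings g hx)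
    (continuous_shift g)

end SetEquippedGraph

/-- The shift map `σ`, `(σ x) i = x (1 + i)`, on a subshift. -/
def subshiftMap {A : Type*} [TopologicalSpace A] (X : Subshift A ℤ) : X.carrier → X.carrier :=
  (X.mapsTo 1).restrict (shift 1) X.carrier X.carrier

/-- Two subshifts are conjugate if some homeomorphism between them commutes with the shift maps. -/
def SubshiftConjugate {A B : Type*} [TopologicalSpace A] [TopologicalSpace B]
    (X : Subshift A ℤ) (Y : Subshift B ℤ) : Prop :=
  ∃ φ : X.carrier ≃ₜ Y.carrier, ∀ x, φ (subshiftMap X x) = subshiftMap Y (φ x)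

/-! Since every letter occurs in the shift of an essential graph, such a shift has at least as many
points as letters, and the number of points is a conjugacy invariant; so a shift on `q` letters can
only be conjugate to `X(G, S)` if the latter has at least `q` points.

Conversely, a letter can be added as long as there are more points than letters. If blocks of some
vertex `v` may have a length other than `1`, give the first letter of each block of `v` a new name.
Otherwise all blocks have length `1`; if some vertex `v` has an out-neighbour `a` and another one,
give the letters `v` that are followed by `a` a new name. Both recodings are invertible sliding
block maps. If neither applies, every letter determines the next one, and there are exactly as many
points as letters.

When `X(G, S)` is finite, the past of a point determines its future, so every vertex has a single
out-neighbour and a single block length `s v`. A point is then determined by the block at the origin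
and the position of the origin in it, which leaves `∑ v, s v` points. -/

/-! ### Bi-infinite sequences -/

section IntSequences

theorem exists_int_chain {α : Type*} {R : α → α → Prop} (next : ∀ a, ∃ b, R a b)
    (prev : ∀ b, ∃ a, R a b) (a : α) :
    ∃ f : ℤ → α, f 0 = a ∧ ∀ i, R (f i) (f (i + 1)) := by
  choose s hs using next
  choose r hr using prev
  let f : ℤ → α
    | Int.ofNat n => s^[n] a
    | Int.negSucc n => r^[n + 1] a
  refine ⟨f, rfl, fun i => ?_⟩
  match i with
  | Int.ofNat n =>
    change R (s^[n] a) (s^[n + 1] a)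
    rw [Function.iterate_succ_apply']
    exact hs _
  | Int.negSucc 0 => exact hr a
  | Int.negSucc (n + 1) =>
    change R (r^[n + 2] a) (r^[n + 1] a)
    rw [Function.iterate_succ_apply' r (n + 1)]
    exact hr _

theorem exists_int_chain_splice {α : Type*} {R : α → α → Prop} {f g : ℤ → α}
    (hf : ∀ i, R (f i) (f (i + 1))) (hg : ∀ i, R (g i) (g (i + 1))) (hfg : R (f 0) (g 0)) :
    ∃ h : ℤ → α, (∀ i, R (h i) (h (i + 1))) ∧ (∀ i ≤ 0, h i = f i) ∧ h 1 = g 0 := by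
  refine ⟨fun i => if i ≤ 0 then f i else g (i - 1), fun i => ?_, fun i hi => if_pos hi, rfl⟩
  rcases lt_trichotomy i 0 with hi | rfl | hi
  · simpa only [if_pos hi.le, if_pos (Int.add_one_le_of_lt hi)] using hf i
  · exact hfg
  · simpa [hi.not_ge, (Int.lt_add_one_of_le hi.le).not_ge] using hg (i - 1)

theorem int_chain_eq_of_biUnique {α : Type*} {R : α → α → Prop} (hR : Relator.BiUnique R)
    {f g : ℤ → α} (hf : ∀ i, R (f i) (f (i + 1))) (hg : ∀ i, R (g i) (g (i + 1)))
    (h0 : f 0 = g 0) : f = g := by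
  funext i
  induction i with
  | zero => exact h0
  | succ i ih => exact hR.2 (hf i) (ih ▸ hg i)
  | pred i ih =>
    have hfi := hf (-(i : ℤ) - 1)
    have hgi := hg (-(i : ℤ) - 1)
    rw [sub_add_cancel] at hfi hgi
    exact hR.1 hfi (ih ▸ hgi)

theorem exists_mem_Ico_succ {t : ℤ → ℤ} (ht : StrictMono t) (k : ℤ) :
    ∃ i, t i ≤ k ∧ k < t (i + 1) := by
  obtain ⟨_, ⟨a, rfl⟩, ha⟩ := not_bddBelow_iff.1 ht.not_bddBelow_range_of_isPredArchimedean k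
  obtain ⟨_, ⟨b, rfl⟩, hb⟩ := not_bddAbove_iff.1 ht.not_bddAbove_range_of_isSuccArchimedean k
  obtain ⟨i, hi, hmax⟩ := Int.exists_greatest_of_bdd (P := fun i => t i ≤ k)
    ⟨b, fun z hz => (ht.lt_iff_lt.1 (hz.trans_lt hb)).le⟩ ⟨a, ha.le⟩
  exact ⟨i, hi, lt_of_not_ge fun h => (lt_add_one i).not_ge (hmax _ h)⟩

theorem eq_of_mem_Ico_succ {t : ℤ → ℤ} (ht : StrictMono t) {i j k : ℤ} (hi : t i ≤ k)
    (hi' : k < t (i + 1)) (hj : t j ≤ k) (hj' : k < t (j + 1)) : i = j := by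
  have hij := ht.lt_iff_lt.1 (hi.trans_lt hj')
  have hji := ht.lt_iff_lt.1 (hj.trans_lt hi')
  omega

/-- Every point of `X` is periodic, so it can be recovered from its past. -/
theorem eq_of_eqOn_Iio_of_finite {A : Type*} {X : Set (ℤ → A)} (hX : X.Finite)
    (hshift : ∀ g : ℤ, Set.MapsTo (shift g) X X) {x y : ℤ → A} (hx : x ∈ X) (hy : y ∈ X)
    (hxy : Set.EqOn x y (Set.Iio 0)) : x = y := by
  have : Finite X := hX
  obtain ⟨m, n, hmn, heq⟩ := Finite.exists_ne_map_eq_of_infinite fun g : ℤ =>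
    ((⟨shift g x, hshift g hx⟩, ⟨shift g y, hshift g hy⟩) : X × X)
  have periodic_of_shift_eq : ∀ z : ℤ → A, shift m z = shift n z →
      Function.Periodic z (n - m) := fun z hz k => by
    simpa [add_sub_left_comm] using (congrFun hz (k - m)).symm
  have hpx := periodic_of_shift_eq x (congrArg (fun p => p.1.1) heq)
  have hpy := periodic_of_shift_eq y (congrArg (fun p => p.2.1) heq)
  have hsq : 0 < (n - m) * (n - m) := mul_self_pos.2 (sub_ne_zero.2 hmn.symm)
  funext k
  have hneg : k - ((|k| + 1) * (n - m)) • (n - m) ∈ Set.Iio 0 := by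
    rw [Set.mem_Iio, smul_eq_mul, mul_assoc]
    nlinarith [le_abs_self k, abs_nonneg k]
  rw [← hpx.sub_zsmul_eq, ← hpy.sub_zsmul_eq, hxy hneg]

end IntSequences

/-! ### Blocks of a string -/

namespace SetEquippedGraph

variable {V : Type*} {𝒢 : SetEquippedGraph V}

theorem ne_of_adj {u v : V} (h : 𝒢.graph.Adj u v) : u ≠ v := by
  rintro rfl
  exact 𝒢.loopless _ h

/-- A block with letter `a.1` starting at position `a.2` can be followed immediately by a block
with letter `b.1` starting at position `b.2`. -/
def BlockStep (𝒢 : SetEquippedGraph V) (a b : V × ℤ) : Prop :=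
  𝒢.graph.Adj a.1 b.1 ∧ ∃ n ∈ 𝒢.S a.1, b.2 = a.2 + n

theorem BlockStep.snd_lt {a b : V × ℤ} (h : 𝒢.BlockStep a b) : a.2 < b.2 := by
  obtain ⟨-, n, hn, hab⟩ := h
  have := 𝒢.pos _ _ hn
  omega

/-- The sequence `f` lists the letters and the starting positions of the consecutive blocks into
which the string `x` is cut. -/
structure IsBlockDecomposition (𝒢 : SetEquippedGraph V) (x : ℤ → V) (f : ℤ → V × ℤ) : Prop where
  step : ∀ i, 𝒢.BlockStep (f i) (f (i + 1))
  apply_eq : ∀ i k, (f i).2 ≤ k → k < (f (i + 1)).2 → x k = (f i).1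

theorem mem_blockStrings_iff_exists_isBlockDecomposition {x : ℤ → V} :
    x ∈ 𝒢.blockStrings ↔ ∃ f, 𝒢.IsBlockDecomposition x f := by
  constructor
  · rintro ⟨u, n, t, hn, hu, ht, hx⟩
    exact ⟨fun i => (u i, t i), fun i => ⟨hu i, n i, hn i, ht i⟩, hx⟩
  · rintro ⟨f, hf⟩
    choose n hn ht using fun i => (hf.step i).2
    exact ⟨fun i => (f i).1, n, fun i => (f i).2, hn, fun i => (hf.step i).1, ht, hf.apply_eq⟩

theorem strictMono_of_blockStep {f : ℤ → V × ℤ} (hf : ∀ i, 𝒢.BlockStep (f i) (f (i + 1))) :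
    StrictMono fun i => (f i).2 :=
  strictMono_int_of_lt_succ fun i => (hf i).snd_lt

theorem exists_isBlockDecomposition {f : ℤ → V × ℤ}
    (hf : ∀ i, 𝒢.BlockStep (f i) (f (i + 1))) : ∃ x, 𝒢.IsBlockDecomposition x f := by
  have hmono := strictMono_of_blockStep hf
  choose i hi hi' using exists_mem_Ico_succ hmono
  exact ⟨fun k => (f (i k)).1, hf, fun j k hj hj' =>
    congrArg (fun j => (f j).1) (eq_of_mem_Ico_succ hmono (hi k) (hi' k) hj hj')⟩

theorem exists_blockStep_chain (hess : 𝒢.graph.IsEssential) (a : V × ℤ) :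
    ∃ f : ℤ → V × ℤ, f 0 = a ∧ ∀ i, 𝒢.BlockStep (f i) (f (i + 1)) := by
  refine exists_int_chain (fun a => ?_) (fun b => ?_) a
  · obtain ⟨w, hw⟩ := (hess a.1).2
    obtain ⟨n, hn⟩ := 𝒢.nonempty a.1
    exact ⟨(w, a.2 + n), hw, n, hn, rfl⟩
  · obtain ⟨u, hu⟩ := (hess b.1).1
    obtain ⟨n, hn⟩ := 𝒢.nonempty u
    exact ⟨(u, b.2 - n), hu, n, hn, (sub_add_cancel _ _).symm⟩

/-- A maximal run of equal letters of `x`, occupying the positions `a, …, a + n - 1`, that is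
allowed by `𝒢` as a block followed by the next letter of `x`. Adjacency to the preceding letter
is left to the preceding block. -/
structure IsBlock (𝒢 : SetEquippedGraph V) (x : ℤ → V) (a : ℤ) (n : ℕ) : Prop where
  mem : n ∈ 𝒢.S (x a)
  start : x (a - 1) ≠ x a
  const : ∀ k, a ≤ k → k < a + n → x k = x a
  adj : 𝒢.graph.Adj (x a) (x (a + n))

namespace IsBlockDecomposition

variable {x y : ℤ → V} {f g : ℤ → V × ℤ}

theorem apply_start (h : 𝒢.IsBlockDecomposition x f) (i : ℤ) : x (f i).2 = (f i).1 :=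
  h.apply_eq i _ le_rfl (h.step i).snd_lt

theorem unique (hx : 𝒢.IsBlockDecomposition x f) (hy : 𝒢.IsBlockDecomposition y f) : x = y := by
  funext k
  obtain ⟨i, hi, hi'⟩ := exists_mem_Ico_succ (strictMono_of_blockStep hx.step) k
  rw [hx.apply_eq i k hi hi', hy.apply_eq i k hi hi']

theorem comp_add_left (h : 𝒢.IsBlockDecomposition x f) (i : ℤ) :
    𝒢.IsBlockDecomposition x fun j => f (i + j) where
  step j := add_assoc i j 1 ▸ h.step (i + j)
  apply_eq j := add_assoc i j 1 ▸ h.apply_eq (i + j)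

theorem exists_isBlock (h : 𝒢.IsBlockDecomposition x f) (i : ℤ) :
    ∃ n : ℕ, (f (i + 1)).2 = (f i).2 + n ∧ 𝒢.IsBlock x (f i).2 n := by
  obtain ⟨hadj, n, hn, hni⟩ := h.step i
  have hprev := h.step (i - 1)
  have hlast := h.apply_eq (i - 1) ((f i).2 - 1)
  rw [sub_add_cancel] at hprev hlast
  refine ⟨n, hni, ?_, ?_, fun k hk hk' => ?_, ?_⟩
  · rwa [h.apply_start]
  · rw [h.apply_start, hlast (by have := hprev.snd_lt; omega) (by omega)]
    exact ne_of_adj hprev.1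
  · rw [h.apply_start, h.apply_eq i k hk (by omega)]
  · rwa [← hni, h.apply_start, h.apply_start]

end IsBlockDecomposition

namespace IsBlock

variable {x : ℤ → V} {a b : ℤ} {m n : ℕ}

theorem length_pos (h : 𝒢.IsBlock x a n) : 0 < n := 𝒢.pos _ _ h.mem

theorem apply_add_sub_one (h : 𝒢.IsBlock x a n) : x (a + n - 1) = x a :=
  have := h.length_pos
  h.const _ (by omega) (by omega)

theorem eq_of_mem (ha : 𝒢.IsBlock x a m) (hb : 𝒢.IsBlock x b n) {k : ℤ} (hak : a ≤ k)
    (hkm : k < a + m) (hbk : b ≤ k) (hkn : k < b + n) : a = b ∧ m = n := by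
  have start_le : ∀ {a b : ℤ} {m n : ℕ}, 𝒢.IsBlock x a m → 𝒢.IsBlock x b n → k < a + m →
      b ≤ k → b ≤ a := fun {a b m n} ha hb hkm hbk => by
    by_contra! hlt
    exact hb.start ((ha.const _ (by omega) (by omega)).trans
      (ha.const _ hlt.le (by omega)).symm)
  obtain rfl : a = b := (start_le hb ha hkn hak).antisymm (start_le ha hb hkm hbk)
  have length_le : ∀ {m n : ℕ}, 𝒢.IsBlock x a m → 𝒢.IsBlock x a n → n ≤ m := fun {m n} hm hn => by
    by_contra! hlt
    exact ne_of_adj hm.adj (hn.const _ (by omega) (by omega)).symm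
  exact ⟨rfl, (length_le hb ha).antisymm (length_le ha hb)⟩

theorem exists_next (hx : ∀ k, ∃ (b : ℤ) (n : ℕ), b ≤ k ∧ k < b + n ∧ 𝒢.IsBlock x b n)
    (h : 𝒢.IsBlock x a m) : ∃ n, 𝒢.IsBlock x (a + m) n := by
  obtain ⟨b, n, hb, hbn, hblock⟩ := hx (a + m)
  obtain hlt | rfl := hb.lt_or_eq
  · have := h.length_pos
    obtain ⟨rfl, rfl⟩ :=
      h.eq_of_mem hblock (k := a + m - 1) (by omega) (by omega) (by omega) (by omega)
    omega
  · exact ⟨n, hblock⟩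

theorem exists_prev (hx : ∀ k, ∃ (b : ℤ) (n : ℕ), b ≤ k ∧ k < b + n ∧ 𝒢.IsBlock x b n)
    (h : 𝒢.IsBlock x a m) : ∃ (b : ℤ) (n : ℕ), b + n = a ∧ 𝒢.IsBlock x b n := by
  obtain ⟨b, n, hb, hbn, hblock⟩ := hx (a - 1)
  obtain hlt | heq := (show a ≤ b + n by omega).lt_or_eq
  · have := h.length_pos
    obtain ⟨rfl, rfl⟩ := h.eq_of_mem hblock (k := a) le_rfl (by omega) (by omega) hlt
    omega
  · exact ⟨b, n, heq.symm, hblock⟩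

end IsBlock

theorem mem_blockStrings_iff_forall_isBlock {x : ℤ → V} :
    x ∈ 𝒢.blockStrings ↔ ∀ k, ∃ (a : ℤ) (n : ℕ), a ≤ k ∧ k < a + n ∧ 𝒢.IsBlock x a n := by
  constructor
  · intro hx k
    obtain ⟨f, hf⟩ := mem_blockStrings_iff_exists_isBlockDecomposition.1 hx
    obtain ⟨i, hi, hi'⟩ := exists_mem_Ico_succ (strictMono_of_blockStep hf.step) k
    obtain ⟨n, hn, hblock⟩ := hf.exists_isBlock i
    exact ⟨(f i).2, n, hi, hn ▸ hi', hblock⟩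
  · intro hx
    obtain ⟨a, n, -, -, h₀⟩ := hx 0
    obtain ⟨f, -, hf⟩ := exists_int_chain (α := {b : ℤ × ℕ // 𝒢.IsBlock x b.1 b.2})
      (R := fun b c => b.1.1 + b.1.2 = c.1.1)
      (fun b => let ⟨n, hn⟩ := b.2.exists_next hx; ⟨⟨(_, n), hn⟩, rfl⟩)
      (fun c => let ⟨b, n, hbn, hb⟩ := c.2.exists_prev hx; ⟨⟨(b, n), hb⟩, hbn⟩) ⟨(a, n), h₀⟩
    refine ⟨fun i => x (f i).1.1, fun i => (f i).1.2, fun i => (f i).1.1,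
      fun i => (f i).2.mem, fun i => ?_, fun i => (hf i).symm, fun i k hk hk' => ?_⟩
    · dsimp only
      rw [← hf i]
      exact (f i).2.adj
    · exact (f i).2.const k hk (hf i ▸ hk')

theorem adj_of_ne {x : ℤ → V} (hx : x ∈ 𝒢.blockStrings) {k : ℤ} (h : x (k - 1) ≠ x k) :
    𝒢.graph.Adj (x (k - 1)) (x k) := by
  obtain ⟨a, n, hak, hkn, hblock⟩ := mem_blockStrings_iff_forall_isBlock.1 hx (k - 1)
  obtain hlt | rfl := (show k ≤ a + n by omega).lt_or_eq
  · exact absurd ((hblock.const _ hak hkn).trans (hblock.const k (by omega) hlt).symm) h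
  · rw [hblock.const _ hak hkn]
    exact hblock.adj

theorem adj_of_S_eq_one {x : ℤ → V} (hx : x ∈ 𝒢.blockStrings) {k : ℤ} (h : 𝒢.S (x k) = {1}) :
    𝒢.graph.Adj (x k) (x (k + 1)) := by
  obtain ⟨a, n, hak, hkn, hblock⟩ := mem_blockStrings_iff_forall_isBlock.1 hx k
  have hn : n = 1 := by simpa [← hblock.const k hak hkn, h] using hblock.mem
  obtain rfl : k = a := by omega
  simpa [hn] using hblock.adj

end SetEquippedGraph

/-! ### Sliding block maps -/

theorem SubshiftConjugate.trans {A B C : Type*} [TopologicalSpace A] [TopologicalSpace B]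
    [TopologicalSpace C] {X : Subshift A ℤ} {Y : Subshift B ℤ} {Z : Subshift C ℤ}
    (hXY : SubshiftConjugate X Y) (hYZ : SubshiftConjugate Y Z) : SubshiftConjugate X Z := by
  obtain ⟨φ, hφ⟩ := hXY
  obtain ⟨ψ, hψ⟩ := hYZ
  exact ⟨φ.trans ψ, fun x => by simp [hφ, hψ]⟩

theorem SubshiftConjugate.encard_eq {A B : Type*} [TopologicalSpace A] [TopologicalSpace B]
    {X : Subshift A ℤ} {Y : Subshift B ℤ} (h : SubshiftConjugate X Y) :
    X.carrier.encard = Y.carrier.encard := by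
  obtain ⟨φ, -⟩ := h
  exact Set.encard_congr φ.toEquiv

/-- The sliding block map with window `[-1, 1]` and local rule `f`. -/
def blockMap {A B : Type*} (f : A → A → A → B) (x : ℤ → A) : ℤ → B :=
  fun k => f (x (k - 1)) (x k) (x (k + 1))

theorem continuous_blockMap {A B : Type*} [TopologicalSpace A] [DiscreteTopology A]
    [TopologicalSpace B] (f : A → A → A → B) : Continuous (blockMap f) := by
  refine continuous_pi fun k => ?_
  have hf : Continuous fun p : A × A × A => f p.1 p.2.1 p.2.2 := continuous_of_discreteTopology
  exact hf.comp (by fun_prop : Continuous fun x : ℤ → A => (x (k - 1), x k, x (k + 1)))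

theorem blockMap_shift {A B : Type*} (f : A → A → A → B) (g : ℤ) (x : ℤ → A) :
    blockMap f (shift g x) = shift g (blockMap f x) := by
  funext k
  simp only [blockMap, shift_apply, add_sub_assoc, add_assoc]

open Classical in
/-- The string obtained from `x` by writing the new letter `none` in place of each letter `v`
whose left and right neighbours satisfy `Q`. -/
noncomputable def mark {V : Type*} (v : V) (Q : V → V → Prop) : (ℤ → V) → ℤ → Option V :=
  blockMap fun u w z => if w = v ∧ Q u z then none else some w

/-- The string obtained from `y` by writing `v` in place of the letter `none`. -/
def unmark {V : Type*} (v : V) : (ℤ → Option V) → ℤ → V :=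
  blockMap fun _ w _ => w.getD v

section mark

variable {V : Type*} {v : V} {Q : V → V → Prop} {x : ℤ → V} {y : ℤ → Option V} {k : ℤ}

theorem mark_of_pos (hv : x k = v) (hQ : Q (x (k - 1)) (x (k + 1))) : mark v Q x k = none :=
  if_pos ⟨hv, hQ⟩

theorem mark_of_neg (hQ : ¬ Q (x (k - 1)) (x (k + 1))) : mark v Q x k = some (x k) :=
  if_neg fun h => hQ h.2

theorem mark_of_ne (hv : x k ≠ v) : mark v Q x k = some (x k) :=
  if_neg fun h => hv h.1

theorem mark_eq_none_or_some :
    (x k = v ∧ mark v Q x k = none) ∨ mark v Q x k = some (x k) := by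
  by_cases h : x k = v ∧ Q (x (k - 1)) (x (k + 1))
  · exact Or.inl ⟨h.1, if_pos h⟩
  · exact Or.inr (if_neg h)

theorem unmark_of_none (h : y k = none) : unmark v y k = v := by
  simp [unmark, blockMap, h]

theorem unmark_of_some {w : V} (h : y k = some w) : unmark v y k = w := by
  simp [unmark, blockMap, h]

theorem getD_mark : (mark v Q x k).getD v = x k := by
  obtain ⟨hv, h⟩ | h := mark_eq_none_or_some (x := x) (k := k) (v := v) (Q := Q)
  · rw [h, hv, Option.getD_none]
  · rw [h, Option.getD_some]

theorem unmark_mark : unmark v (mark v Q x) = x := funext fun _ => getD_mark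

theorem mark_apply_ne {j : ℤ} (h : x j ≠ x k) : mark v Q x j ≠ mark v Q x k := fun heq =>
  h (getD_mark.symm.trans ((congrArg (fun o : Option V => o.getD v) heq).trans getD_mark))

theorem mark_unmark (h : ∀ k, unmark v y k = v →
    (y k = none ↔ Q (unmark v y (k - 1)) (unmark v y (k + 1)))) :
    mark v Q (unmark v y) = y := by
  funext k
  cases hk : y k with
  | none =>
    have hv := unmark_of_none (v := v) hk
    exact mark_of_pos hv ((h k hv).1 hk)
  | some w =>
    rw [← unmark_of_some (v := v) hk]
    by_cases hv : unmark v y k = v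
    · exact mark_of_neg fun hQ => by simpa [hk] using (h k hv).2 hQ
    · exact mark_of_ne hv

end mark

namespace SetEquippedGraph

section conjugate

variable {V W : Type*} [TopologicalSpace V] [DiscreteTopology V] [TopologicalSpace W]
  [DiscreteTopology W]

theorem conjugate_of_blockMap {𝒢 : SetEquippedGraph V} {ℋ : SetEquippedGraph W}
    (f : V → V → V → W) (g : W → W → W → V)
    (hf : Set.MapsTo (blockMap f) 𝒢.blockStrings ℋ.blockStrings)
    (hg : Set.MapsTo (blockMap g) ℋ.blockStrings 𝒢.blockStrings)
    (hgf : Set.LeftInvOn (blockMap g) (blockMap f) 𝒢.blockStrings)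
    (hfg : Set.LeftInvOn (blockMap f) (blockMap g) ℋ.blockStrings) :
    SubshiftConjugate 𝒢.sgraphShift ℋ.sgraphShift := by
  have cf := continuous_blockMap f
  have cg := continuous_blockMap g
  have hf_closure := hf.closure cf
  have hg_closure := hg.closure cg
  have hgf_closure : Set.EqOn (blockMap g ∘ blockMap f) id (closure 𝒢.blockStrings) :=
    Set.EqOn.closure (fun _ hx => hgf hx) (cg.comp cf) continuous_id
  have hfg_closure : Set.EqOn (blockMap f ∘ blockMap g) id (closure ℋ.blockStrings) :=
    Set.EqOn.closure (fun _ hy => hfg hy) (cf.comp cg) continuous_id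
  exact ⟨⟨⟨hf_closure.restrict, hg_closure.restrict, fun x => Subtype.ext (hgf_closure x.2),
    fun y => Subtype.ext (hfg_closure y.2)⟩, cf.restrict hf_closure, cg.restrict hg_closure⟩,
    fun x => Subtype.ext (blockMap_shift f 1 x.1)⟩

theorem conjugate_of_mark [TopologicalSpace (Option V)] [DiscreteTopology (Option V)]
    {𝒢 : SetEquippedGraph V} {ℋ : SetEquippedGraph (Option V)} {v : V} {Q : V → V → Prop}
    (hmark : Set.MapsTo (mark v Q) 𝒢.blockStrings ℋ.blockStrings)
    (hunmark : Set.MapsTo (unmark v) ℋ.blockStrings 𝒢.blockStrings)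
    (hinv : Set.LeftInvOn (mark v Q) (unmark v) ℋ.blockStrings) :
    SubshiftConjugate 𝒢.sgraphShift ℋ.sgraphShift :=
  conjugate_of_blockMap _ _ hmark hunmark (fun _ _ => unmark_mark) hinv

end conjugate

/-! ### Relabelling the vertices -/

section relabel

variable {V W : Type*} (𝒢 : SetEquippedGraph V) (e : W ≃ V)

/-- The copy of `𝒢` on `W` obtained along the bijection `e`. -/
def relabel : SetEquippedGraph W where
  graph := ⟨fun u w => 𝒢.graph.Adj (e u) (e w)⟩
  loopless u := 𝒢.loopless (e u)
  S u := 𝒢.S (e u)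
  nonempty u := 𝒢.nonempty (e u)
  pos u := 𝒢.pos (e u)

theorem relabel_isEssential (hess : 𝒢.graph.IsEssential) :
    (𝒢.relabel e).graph.IsEssential := fun w => by
  obtain ⟨⟨u, hu⟩, z, hz⟩ := hess (e w)
  rw [← e.apply_symm_apply u] at hu
  rw [← e.apply_symm_apply z] at hz
  exact ⟨⟨_, hu⟩, _, hz⟩

theorem mem_blockStrings_relabel_iff {x : ℤ → W} :
    x ∈ (𝒢.relabel e).blockStrings ↔ e ∘ x ∈ 𝒢.blockStrings := by
  have isBlock_iff : ∀ a n, (𝒢.relabel e).IsBlock x a n ↔ 𝒢.IsBlock (e ∘ x) a n := fun a n =>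
    ⟨fun h => ⟨h.mem, e.injective.ne h.start, fun k hk hk' => congrArg e (h.const k hk hk'), h.adj⟩,
      fun h => ⟨h.mem, e.injective.ne_iff.1 h.start,
        fun k hk hk' => e.injective (h.const k hk hk'), h.adj⟩⟩
  simp only [mem_blockStrings_iff_forall_isBlock, isBlock_iff]

theorem relabel_conjugate [TopologicalSpace V] [DiscreteTopology V] [TopologicalSpace W]
    [DiscreteTopology W] : SubshiftConjugate 𝒢.sgraphShift (𝒢.relabel e).sgraphShift := by
  have he : ∀ x : ℤ → V, e ∘ (e.symm ∘ x) = x := fun x => funext fun k => e.apply_symm_apply _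
  exact conjugate_of_blockMap (fun _ w _ => e.symm w) (fun _ w _ => e w)
    (fun x hx => (𝒢.mem_blockStrings_relabel_iff e).2 ((he x).symm ▸ hx))
    (fun y hy => (𝒢.mem_blockStrings_relabel_iff e).1 hy) (fun x _ => he x)
    fun y _ => funext fun k => e.symm_apply_apply _

end relabel

end SetEquippedGraph

/-! ### Splitting off the head of the blocks of a vertex -/

namespace SetEquippedGraph

section splitHead

variable {V : Type*} (𝒢 : SetEquippedGraph V) (v : V)

/-- Adjacency in the graph `splitHead`: every edge into `v` is redirected to the new vertex `none`,
which leads to `v` and, if blocks of length `1` were allowed at `v`, to the out-neighbours of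
`v`. -/
inductive SplitHeadAdj : Option V → Option V → Prop
  | enter {u : V} : 𝒢.graph.Adj u v → SplitHeadAdj (some u) none
  | stay : SplitHeadAdj none (some v)
  | exit {w : V} : 1 ∈ 𝒢.S v → 𝒢.graph.Adj v w → SplitHeadAdj none (some w)
  | other {u w : V} : w ≠ v → 𝒢.graph.Adj u w → SplitHeadAdj (some u) (some w)

open Classical in
/-- The set-equipped graph whose strings are obtained from those of `𝒢` by renaming the first
letter of each block of `v` to `none`. -/
noncomputable def splitHead (hv : ∃ n ∈ 𝒢.S v, n ≠ 1) : SetEquippedGraph (Option V) where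
  graph := ⟨SplitHeadAdj 𝒢 v⟩
  loopless
    | none => nofun
    | some u => fun | .other _ h => 𝒢.loopless u h
  S
    | none => {1}
    | some w => if w = v then {n | 0 < n ∧ n + 1 ∈ 𝒢.S v} else 𝒢.S w
  nonempty
    | none => Set.singleton_nonempty 1
    | some w => by
      obtain ⟨n, hn, hn1⟩ := hv
      have := 𝒢.pos v n hn
      dsimp only
      split_ifs
      · exact ⟨n - 1, by omega, by rwa [Nat.sub_add_cancel this]⟩
      · exact 𝒢.nonempty w
  pos
    | none => fun n hn => hn ▸ one_pos
    | some w => fun n hn => by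
      dsimp only at hn
      split_ifs at hn
      · exact hn.1
      · exact 𝒢.pos w n hn

variable {𝒢 v} {hv : ∃ n ∈ 𝒢.S v, n ≠ 1}

theorem splitHead_S_self : (𝒢.splitHead v hv).S (some v) = {n | 0 < n ∧ n + 1 ∈ 𝒢.S v} :=
  if_pos rfl

theorem splitHead_S_of_ne {w : V} (hw : w ≠ v) : (𝒢.splitHead v hv).S (some w) = 𝒢.S w :=
  if_neg hw

theorem splitHead_isEssential (hess : 𝒢.graph.IsEssential) :
    (𝒢.splitHead v hv).graph.IsEssential := by
  have exists_adj_some : ∀ u, ∃ w, (𝒢.splitHead v hv).graph.Adj (some u) w := fun u => by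
    obtain ⟨w, hw⟩ := (hess u).2
    obtain rfl | hwv := eq_or_ne w v
    · exact ⟨none, .enter hw⟩
    · exact ⟨some w, .other hwv hw⟩
  rintro (_ | w)
  · obtain ⟨u, hu⟩ := (hess v).1
    exact ⟨⟨some u, .enter hu⟩, some v, .stay⟩
  · refine ⟨?_, exists_adj_some w⟩
    obtain rfl | hwv := eq_or_ne w v
    · exact ⟨none, .stay⟩
    · obtain ⟨u, hu⟩ := (hess w).1
      exact ⟨some u, .other hwv hu⟩

section mark

variable {x : ℤ → V} {a : ℤ} {n : ℕ}

theorem IsBlock.splitHead_mark_of_ne (h : 𝒢.IsBlock x a n) (ha : x a ≠ v) :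
    (𝒢.splitHead v hv).IsBlock (mark v (fun u _ => u ≠ v) x) a n where
  mem := by
    rw [mark_of_ne ha, splitHead_S_of_ne ha]
    exact h.mem
  start := mark_apply_ne h.start
  const k hk hk' := by
    rw [mark_of_ne ha, mark_of_ne ((h.const k hk hk').trans_ne ha), h.const k hk hk']
  adj := by
    rw [mark_of_ne ha]
    have hadj := h.adj
    obtain hn | hn := eq_or_ne (x (a + n)) v
    · rw [mark_of_pos hn (h.apply_add_sub_one ▸ ha)]
      exact .enter (hn ▸ hadj)
    · rw [mark_of_ne hn]
      exact .other hn hadj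

theorem IsBlock.splitHead_mark_head (h : 𝒢.IsBlock x a n) (ha : x a = v) :
    (𝒢.splitHead v hv).IsBlock (mark v (fun u _ => u ≠ v) x) a 1 := by
  have hhead : mark v (fun u _ => u ≠ v) x a = none := mark_of_pos ha (ha ▸ h.start)
  refine ⟨hhead ▸ Set.mem_singleton 1, mark_apply_ne h.start, fun k hk hk' => ?_, ?_⟩
  · rw [show k = a by omega]
  · have hsnd : mark v (fun u _ => u ≠ v) x (a + 1) = some (x (a + 1)) :=
      mark_of_neg (by simpa using ha)
    rw [Nat.cast_one, hhead, hsnd]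
    obtain rfl | hn := eq_or_ne n 1
    · exact .exit (ha ▸ h.mem) (ha ▸ h.adj)
    · have := h.length_pos
      rw [h.const _ (by omega) (by omega), ha]
      exact .stay

theorem IsBlock.splitHead_mark_tail (h : 𝒢.IsBlock x a (n + 1)) (ha : x a = v) (hn : 0 < n) :
    (𝒢.splitHead v hv).IsBlock (mark v (fun u _ => u ≠ v) x) (a + 1) n := by
  have hprev : ∀ k, a < k → k ≤ a + n + 1 → x (k - 1) = v := fun k hk hk' =>
    (h.const (k - 1) (by omega) (by omega)).trans ha
  have htail : ∀ k, a < k → k ≤ a + n → mark v (fun u _ => u ≠ v) x k = some v :=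
    fun k hk hk' => by
      rw [mark_of_neg (not_not.2 (hprev k hk (by omega))), h.const k hk.le (by omega), ha]
  have hadj := h.adj
  rw [ha, Nat.cast_succ, ← add_assoc] at hadj
  refine ⟨?_, ?_, fun k hk hk' => ?_, ?_⟩
  · rw [htail _ (by omega) (by omega), splitHead_S_self]
    exact ⟨hn, ha ▸ h.mem⟩
  · rw [add_sub_cancel_right, mark_of_pos ha (ha ▸ h.start), htail _ (by omega) (by omega)]
    nofun
  · rw [htail k (by omega) (by omega), htail _ (by omega) (by omega)]
  · rw [htail _ (by omega) (by omega), add_right_comm,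
      mark_of_neg (not_not.2 (hprev _ (by omega) (by omega)))]
    exact .other (ne_of_adj hadj).symm hadj

theorem mark_mem_blockStrings_splitHead (hx : x ∈ 𝒢.blockStrings) :
    mark v (fun u _ => u ≠ v) x ∈ (𝒢.splitHead v hv).blockStrings := by
  rw [mem_blockStrings_iff_forall_isBlock] at hx ⊢
  intro k
  obtain ⟨a, n, hak, hkn, h⟩ := hx k
  obtain ha | ha := ne_or_eq (x a) v
  · exact ⟨a, n, hak, hkn, h.splitHead_mark_of_ne ha⟩
  · obtain rfl | hlt := hak.eq_or_lt
    · exact ⟨a, 1, le_rfl, by omega, h.splitHead_mark_head ha⟩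
    · obtain ⟨n, rfl⟩ := Nat.exists_eq_succ_of_ne_zero h.length_pos.ne'
      exact ⟨a + 1, n, hlt, by omega, h.splitHead_mark_tail ha (by omega)⟩

end mark

section unmark

variable {y : ℤ → Option V} {a : ℤ} {n : ℕ}

theorem splitHeadAdj_or_eq_some (hy : y ∈ (𝒢.splitHead v hv).blockStrings) (k : ℤ) :
    SplitHeadAdj 𝒢 v (y (k - 1)) (y k) ∨ ∃ w, y (k - 1) = some w ∧ y k = some w := by
  by_cases hne : y (k - 1) = y k
  · cases hk : y k with
    | none =>
      have hS : (𝒢.splitHead v hv).S (y (k - 1)) = {1} := by rw [hne, hk]; rfl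
      have := adj_of_S_eq_one hy hS
      rw [sub_add_cancel, hk] at this
      exact .inl this
    | some w => exact .inr ⟨w, hne.trans hk, rfl⟩
  · exact .inl (adj_of_ne hy hne)

theorem unmark_sub_one_ne_of_eq_none (hy : y ∈ (𝒢.splitHead v hv).blockStrings) {k : ℤ}
    (hk : y k = none) : unmark v y (k - 1) ≠ v := by
  obtain h | ⟨w, -, hw⟩ := splitHeadAdj_or_eq_some hy k
  · rw [hk] at h
    cases hu : y (k - 1) with
    | none =>
      rw [hu] at h
      cases h
    | some u =>
      rw [hu] at h
      cases h with | enter h => exact unmark_of_some hu ▸ ne_of_adj h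
  · exact absurd (hk.symm.trans hw) (Option.some_ne_none w).symm

theorem eq_none_or_eq_of_eq_some_self (hy : y ∈ (𝒢.splitHead v hv).blockStrings) {k : ℤ}
    (hk : y k = some v) : y (k - 1) = none ∨ y (k - 1) = some v := by
  obtain h | ⟨w, hu, hw⟩ := splitHeadAdj_or_eq_some hy k
  · rw [hk] at h
    cases hu : y (k - 1) with
    | none => exact .inl rfl
    | some u =>
      rw [hu] at h
      cases h with | other h _ => exact absurd rfl h
  · exact .inr (hu.trans (hw.symm.trans hk))

theorem mark_unmark_of_mem_splitHead (hy : y ∈ (𝒢.splitHead v hv).blockStrings) :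
    mark v (fun u _ => u ≠ v) (unmark v y) = y := by
  refine mark_unmark fun k hkv => ?_
  cases hk : y k with
  | none => simpa using unmark_sub_one_ne_of_eq_none hy hk
  | some w =>
    obtain rfl : w = v := (unmark_of_some hk).symm.trans hkv
    obtain h | h := eq_none_or_eq_of_eq_some_self hy hk
    · simpa using unmark_of_none h
    · simpa using unmark_of_some h

theorem SplitHeadAdj.adj_unmark {u : V} {k : ℤ} (h : SplitHeadAdj 𝒢 v (some u) (y k)) :
    𝒢.graph.Adj u (unmark v y k) := by
  cases hk : y k with
  | none =>
    rw [hk] at h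
    cases h with | enter h => exact (unmark_of_none hk).symm ▸ h
  | some w =>
    rw [hk] at h
    cases h with | other _ h => exact (unmark_of_some hk).symm ▸ h

theorem IsBlock.unmark_of_ne {w : V} (h : (𝒢.splitHead v hv).IsBlock y a n)
    (ha : y a = some w) (hw : w ≠ v) : 𝒢.IsBlock (unmark v y) a n := by
  have hxa : unmark v y a = w := unmark_of_some ha
  have hmem := h.mem
  have hstart := h.start
  have hadj := h.adj
  rw [ha] at hmem hstart hadj
  refine ⟨hxa ▸ splitHead_S_of_ne hw ▸ hmem, ?_, fun k hk hk' => ?_, hxa ▸ hadj.adj_unmark⟩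
  · rw [hxa]
    cases hu : y (a - 1) with
    | none => exact (unmark_of_none hu).trans_ne hw.symm
    | some u => exact (unmark_of_some hu).trans_ne fun huw => hstart (hu.trans (congrArg some huw))
  · rw [hxa, unmark_of_some ((h.const k hk hk').trans ha)]

theorem IsBlock.unmark_of_exit (hy : y ∈ (𝒢.splitHead v hv).blockStrings) (ha : y a = none)
    (hone : 1 ∈ 𝒢.S v) (hadj : 𝒢.graph.Adj v (unmark v y (a + 1))) :
    𝒢.IsBlock (unmark v y) a 1 := by
  have hxa : unmark v y a = v := unmark_of_none ha
  refine ⟨hxa.symm ▸ hone, hxa.symm ▸ unmark_sub_one_ne_of_eq_none hy ha, fun k hk hk' => ?_, ?_⟩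
  · rw [show k = a by omega]
  · rwa [hxa, Nat.cast_one]

theorem IsBlock.unmark_of_stay (hy : y ∈ (𝒢.splitHead v hv).blockStrings) (ha : y a = none)
    (h : (𝒢.splitHead v hv).IsBlock y (a + 1) n) (ha' : y (a + 1) = some v) :
    𝒢.IsBlock (unmark v y) a (n + 1) := by
  have hxa : unmark v y a = v := unmark_of_none ha
  have hmem := h.mem
  have hadj := h.adj
  rw [ha', splitHead_S_self] at hmem
  rw [ha', add_right_comm, add_assoc] at hadj
  refine ⟨hxa.symm ▸ hmem.2, hxa.symm ▸ unmark_sub_one_ne_of_eq_none hy ha,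
    fun k hk hk' => ?_, ?_⟩
  · obtain rfl | hlt := hk.eq_or_lt
    · rfl
    · rw [hxa, unmark_of_some ((h.const k hlt (by omega)).trans ha')]
  · rw [hxa, Nat.cast_succ]
    exact hadj.adj_unmark

theorem unmark_mem_blockStrings_of_splitHead (hy : y ∈ (𝒢.splitHead v hv).blockStrings) :
    unmark v y ∈ 𝒢.blockStrings := by
  have hblock := mem_blockStrings_iff_forall_isBlock.1 hy
  rw [mem_blockStrings_iff_forall_isBlock]
  intro k
  obtain ⟨a, n, hak, hkn, h⟩ := hblock k
  cases ha : y a with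
  | none =>
    obtain rfl : n = 1 := by
      have hmem := h.mem
      rwa [ha] at hmem
    obtain rfl : k = a := by omega
    have hadj := h.adj
    obtain ⟨m, hnext⟩ := h.exists_next hblock
    rw [Nat.cast_one] at hadj hnext
    rw [ha] at hadj
    generalize hw : y (k + 1) = o at hadj
    cases hadj with
    | stay => exact ⟨k, m + 1, le_rfl, by omega, .unmark_of_stay hy ha hnext hw⟩
    | exit hone hvw =>
      exact ⟨k, 1, le_rfl, by omega, .unmark_of_exit hy ha hone (unmark_of_some hw ▸ hvw)⟩
  | some w =>
    obtain hwv | rfl := ne_or_eq w v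
    · exact ⟨a, n, hak, hkn, h.unmark_of_ne ha hwv⟩
    · obtain hprev | hprev := eq_none_or_eq_of_eq_some_self hy ha
      · rw [← sub_add_cancel a 1] at h ha
        exact ⟨a - 1, n + 1, by omega, by omega, .unmark_of_stay hy hprev h ha⟩
      · exact absurd (hprev.trans ha.symm) h.start

end unmark

theorem splitHead_conjugate [TopologicalSpace V] [DiscreteTopology V]
    [TopologicalSpace (Option V)] [DiscreteTopology (Option V)] :
    SubshiftConjugate 𝒢.sgraphShift (𝒢.splitHead v hv).sgraphShift :=
  conjugate_of_mark (fun _ => mark_mem_blockStrings_splitHead)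
    (fun _ => unmark_mem_blockStrings_of_splitHead) fun _ => mark_unmark_of_mem_splitHead

end splitHead

/-! ### Splitting off an edge -/

section splitOut

variable {V : Type*} (𝒢 : SetEquippedGraph V) (v a : V)

/-- Adjacency in the graph `splitOut`: the edge from `v` to `a` is given to the new vertex `none`,
a copy of `v` with the same in-neighbours as `v`. -/
inductive SplitOutAdj : Option V → Option V → Prop
  | enter {u : V} : 𝒢.graph.Adj u v → SplitOutAdj (some u) none
  | exit : SplitOutAdj none (some a)
  | other {u w : V} : ¬ (u = v ∧ w = a) → 𝒢.graph.Adj u w → SplitOutAdj (some u) (some w)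

/-- The set-equipped graph whose strings are obtained from those of `𝒢` by renaming each letter
`v` followed by `a` to `none`, provided that `v` is adjacent to `a` and only has blocks of
length `1`. -/
def splitOut : SetEquippedGraph (Option V) where
  graph := ⟨SplitOutAdj 𝒢 v a⟩
  loopless
    | none => nofun
    | some u => fun | .other _ h => 𝒢.loopless u h
  S
    | none => {1}
    | some w => 𝒢.S w
  nonempty
    | none => Set.singleton_nonempty 1
    | some w => 𝒢.nonempty w
  pos
    | none => fun _ hn => hn ▸ one_pos
    | some w => 𝒢.pos w

variable {𝒢 v a}

theorem splitOut_isEssential (hess : 𝒢.graph.IsEssential) {b : V} (hvb : 𝒢.graph.Adj v b)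
    (hba : b ≠ a) : (𝒢.splitOut v a).graph.IsEssential := by
  rintro (_ | w)
  · obtain ⟨u, hu⟩ := (hess v).1
    exact ⟨⟨some u, .enter hu⟩, some a, .exit⟩
  · obtain ⟨⟨u, hu⟩, z, hz⟩ := hess w
    constructor
    · by_cases h : u = v ∧ w = a
      · exact ⟨none, h.2 ▸ .exit⟩
      · exact ⟨some u, .other h hu⟩
    · by_cases h : w = v
      · exact ⟨some b, .other (fun h' => hba h'.2) (h ▸ hvb)⟩
      · exact ⟨some z, .other (fun h' => h h'.1) hz⟩

theorem SplitOutAdj.adj_getD (ha : 𝒢.graph.Adj v a) {o o' : Option V}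
    (h : SplitOutAdj 𝒢 v a o o') : 𝒢.graph.Adj (o.getD v) (o'.getD v) := by
  cases h with
  | enter h => exact h
  | exit => exact ha
  | other _ h => exact h

theorem splitOut_S (hS : 𝒢.S v = {1}) (o : Option V) :
    (𝒢.splitOut v a).S o = 𝒢.S (o.getD v) := by
  cases o with
  | none => exact hS.symm
  | some w => rfl

/-- Here `unmark` is a graph homomorphism that preserves the block lengths. -/
theorem unmark_mem_blockStrings_of_splitOut (hS : 𝒢.S v = {1}) (ha : 𝒢.graph.Adj v a)
    {y : ℤ → Option V} (hy : y ∈ (𝒢.splitOut v a).blockStrings) :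
    unmark v y ∈ 𝒢.blockStrings := by
  obtain ⟨u, n, t, hn, hu, ht, hy⟩ := hy
  exact ⟨fun i => (u i).getD v, n, t, fun i => splitOut_S hS (u i) ▸ hn i,
    fun i => (hu i).adj_getD ha, ht,
    fun i k hk hk' => congrArg (fun o : Option V => o.getD v) (hy i k hk hk')⟩

theorem splitOutAdj_mark {x : ℤ → V} {k : ℤ} (h : 𝒢.graph.Adj (x (k - 1)) (x k)) :
    SplitOutAdj 𝒢 v a (mark v (fun _ z => z = a) x (k - 1)) (mark v (fun _ z => z = a) x k) := by
  by_cases hva : x (k - 1) = v ∧ x k = a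
  · rw [mark_of_pos hva.1 ((sub_add_cancel k 1).symm ▸ hva.2),
      mark_of_ne fun hk => ne_of_adj h (hva.1.trans hk.symm), hva.2]
    exact .exit
  · rw [show mark v (fun _ z => z = a) x (k - 1) = some (x (k - 1)) from
      if_neg ((sub_add_cancel k 1).symm ▸ hva)]
    obtain ⟨hk, hmark⟩ | hmark := mark_eq_none_or_some (x := x) (k := k) (v := v)
      (Q := fun _ z => z = a)
    · rw [hmark]
      exact .enter (hk ▸ h)
    · rw [hmark]
      exact .other hva h

theorem mark_mem_blockStrings_splitOut (hS : 𝒢.S v = {1}) {x : ℤ → V}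
    (hx : x ∈ 𝒢.blockStrings) : mark v (fun _ z => z = a) x ∈ (𝒢.splitOut v a).blockStrings := by
  rw [mem_blockStrings_iff_forall_isBlock] at hx ⊢
  intro k
  obtain ⟨b, n, hbk, hkn, h⟩ := hx k
  have hpos := h.length_pos
  have hconst : ∀ j, b ≤ j → j < b + n →
      mark v (fun _ z => z = a) x j = mark v (fun _ z => z = a) x b := fun j hj hj' => by
    obtain hb | hb := eq_or_ne (x b) v
    · obtain rfl : n = 1 := by simpa [hb, hS] using h.mem
      rw [show j = b by omega]
    · rw [mark_of_ne hb, mark_of_ne (h.const j hj hj' ▸ hb), h.const j hj hj']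
  refine ⟨b, n, hbk, hkn, ?_, mark_apply_ne h.start, hconst, ?_⟩
  · rw [splitOut_S hS, getD_mark]
    exact h.mem
  · rw [← hconst (b + n - 1) (by omega) (by omega)]
    exact splitOutAdj_mark (h.apply_add_sub_one.symm ▸ h.adj)

theorem mark_unmark_of_mem_splitOut (hS : 𝒢.S v = {1}) (ha : 𝒢.graph.Adj v a)
    {y : ℤ → Option V} (hy : y ∈ (𝒢.splitOut v a).blockStrings) :
    mark v (fun _ z => z = a) (unmark v y) = y := by
  refine mark_unmark fun k hkv => ?_
  have hadj : SplitOutAdj 𝒢 v a (y k) (y (k + 1)) :=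
    adj_of_S_eq_one hy ((splitOut_S hS _).trans ((congrArg 𝒢.S hkv).trans hS))
  cases hk : y k with
  | none =>
    rw [hk] at hadj
    generalize hz : y (k + 1) = o at hadj
    cases hadj
    simpa using unmark_of_some hz
  | some w =>
    obtain rfl : w = v := (unmark_of_some hk).symm.trans hkv
    rw [hk] at hadj
    generalize hz : y (k + 1) = o at hadj
    cases hadj with
    | enter h => exact absurd h (𝒢.loopless w)
    | other h _ => simpa [unmark_of_some hz] using h

theorem splitOut_conjugate [TopologicalSpace V] [DiscreteTopology V]
    [TopologicalSpace (Option V)] [DiscreteTopology (Option V)] (hS : 𝒢.S v = {1})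
    (ha : 𝒢.graph.Adj v a) :
    SubshiftConjugate 𝒢.sgraphShift (𝒢.splitOut v a).sgraphShift :=
  conjugate_of_mark (fun _ => mark_mem_blockStrings_splitOut hS)
    (fun _ => unmark_mem_blockStrings_of_splitOut hS ha)
    fun _ => mark_unmark_of_mem_splitOut hS ha

end splitOut

end SetEquippedGraph

/-! ### Counting points -/

theorem exists_perm_adj_iff {V : Type*} [Finite V] {G : Digraph V} (hess : G.IsEssential)
    (hG : Relator.RightUnique G.Adj) : ∃ c : Equiv.Perm V, ∀ u v, G.Adj u v ↔ c u = v := by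
  choose f hf using fun v => (hess v).2
  have hadj : ∀ u v, G.Adj u v ↔ f u = v := fun u v =>
    ⟨fun huv => hG (hf u) huv, fun h => h ▸ hf u⟩
  have hsurj : Function.Surjective f := fun v => (hess v).1.imp fun u hu => (hadj u v).1 hu
  exact ⟨Equiv.ofBijective f (Finite.surjective_iff_bijective.1 hsurj), hadj⟩

theorem biUnique_adj_of_rightUnique {V : Type*} [Finite V] {G : Digraph V}
    (hess : G.IsEssential) (hG : Relator.RightUnique G.Adj) : Relator.BiUnique G.Adj := by
  obtain ⟨c, hc⟩ := exists_perm_adj_iff hess hG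
  exact ⟨fun u v w huw hvw => c.injective (((hc u w).1 huw).trans ((hc v w).1 hvw).symm), hG⟩

theorem isDirectedCycle_iff_rightUnique {V : Type*} [Finite V] {G : Digraph V}
    (hess : G.IsEssential) (hirr : G.IsIrreducible) :
    G.IsDirectedCycle ↔ Relator.RightUnique G.Adj := by
  constructor
  · rintro ⟨c, -, hc⟩ u v w huv huw
    exact ((hc u v).1 huv).symm.trans ((hc u w).1 huw)
  · intro hG
    obtain ⟨c, hc⟩ := exists_perm_adj_iff hess hG
    refine ⟨c, ⟨Set.bijOn_univ.2 c.bijective, fun u _ v _ => ?_⟩, hc⟩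
    induction hirr u v with
    | refl => exact .refl _ _
    | tail _ hwz ih =>
      rw [← (hc _ _).1 hwz]
      exact Equiv.Perm.sameCycle_apply_right.2 (ih trivial)

namespace SetEquippedGraph

variable {V : Type*} {𝒢 : SetEquippedGraph V}

theorem encard_carrier_sgraphShift [TopologicalSpace V] [T1Space V] :
    𝒢.sgraphShift.carrier.encard = 𝒢.blockStrings.encard := by
  obtain hfin | hinf := 𝒢.blockStrings.finite_or_infinite
  · exact congrArg Set.encard hfin.isClosed.closure_eq
  · exact (hinf.mono subset_closure).encard_eq.trans hinf.encard_eq.symm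

theorem exists_mem_blockStrings_apply_zero (hess : 𝒢.graph.IsEssential) (v : V) :
    ∃ x ∈ 𝒢.blockStrings, x 0 = v := by
  obtain ⟨f, hf0, hf⟩ := exists_blockStep_chain hess (v, 0)
  obtain ⟨x, hx⟩ := exists_isBlockDecomposition hf
  refine ⟨x, mem_blockStrings_iff_exists_isBlockDecomposition.2 ⟨f, hx⟩, ?_⟩
  simpa only [hf0] using hx.apply_start 0

theorem card_le_encard_blockStrings [Fintype V] (hess : 𝒢.graph.IsEssential) :
    (Fintype.card V : ℕ∞) ≤ 𝒢.blockStrings.encard := by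
  choose x hx hx0 using exists_mem_blockStrings_apply_zero hess
  have hinj : Function.Injective x := fun v w h => by rw [← hx0 v, h, hx0 w]
  rw [← ENat.card_eq_coe_fintype_card]
  exact hinj.encard_range.trans (Set.encard_le_encard (Set.range_subset_iff.2 hx))

theorem exists_common_past (hess : 𝒢.graph.IsEssential) (v : V) :
    ∃ z : ℤ → V, ∀ n ∈ 𝒢.S v, ∀ w, 𝒢.graph.Adj v w → ∃ x ∈ 𝒢.blockStrings,
      Set.EqOn x z (Set.Iio 0) ∧ (∀ k : ℤ, 0 ≤ k → k < n → x k = v) ∧ x n = w := by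
  obtain ⟨f, hf0, hf⟩ := exists_blockStep_chain hess (v, 0)
  obtain ⟨z, hz⟩ := exists_isBlockDecomposition hf
  refine ⟨z, fun n hn w hvw => ?_⟩
  obtain ⟨g, hg0, hg⟩ := exists_blockStep_chain hess (w, (n : ℤ))
  obtain ⟨h, hh, hhf, hh1⟩ := exists_int_chain_splice hf hg
    (by rw [hf0, hg0]; exact ⟨hvw, n, hn, (zero_add _).symm⟩)
  have hh0 : h 0 = (v, 0) := (hhf 0 le_rfl).trans hf0
  rw [hg0] at hh1
  obtain ⟨x, hx⟩ := exists_isBlockDecomposition hh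
  refine ⟨x, mem_blockStrings_iff_exists_isBlockDecomposition.2 ⟨h, hx⟩, fun k hk => ?_,
    fun k hk hkn => ?_, ?_⟩
  · have hmono := strictMono_of_blockStep hf
    obtain ⟨i, hi, hi'⟩ := exists_mem_Ico_succ hmono k
    have hi0 : i < 0 := hmono.lt_iff_lt.1 (hi.trans_lt (by simpa only [hf0, Set.mem_Iio] using hk))
    rw [hz.apply_eq i k hi hi', ← hhf i hi0.le]
    exact hx.apply_eq i k (by rwa [hhf i hi0.le]) (by rwa [hhf (i + 1) hi0])
  · simpa only [hh0] using hx.apply_eq 0 k (by rwa [hh0]) (by rwa [zero_add, hh1])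
  · simpa only [hh1] using hx.apply_start 1

theorem rightUnique_and_subsingleton_of_finite (hess : 𝒢.graph.IsEssential)
    (hfin : 𝒢.blockStrings.Finite) :
    Relator.RightUnique 𝒢.graph.Adj ∧ ∀ v, (𝒢.S v).Subsingleton := by
  have future_unique : ∀ {x y z : ℤ → V}, x ∈ 𝒢.blockStrings → y ∈ 𝒢.blockStrings →
      Set.EqOn x z (Set.Iio 0) → Set.EqOn y z (Set.Iio 0) → x = y := fun hx hy hxz hyz =>
    eq_of_eqOn_Iio_of_finite hfin (fun g _ => 𝒢.shift_mem_blockStrings g) hx hy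
      (hxz.trans hyz.symm)
  constructor
  · intro u v w huv huw
    obtain ⟨n, hn⟩ := 𝒢.nonempty u
    obtain ⟨z, hz⟩ := exists_common_past hess u
    obtain ⟨x, hx, hxz, -, hxn⟩ := hz n hn v huv
    obtain ⟨y, hy, hyz, -, hyn⟩ := hz n hn w huw
    rw [← hxn, ← hyn, future_unique hx hy hxz hyz]
  · intro v
    obtain ⟨z, hz⟩ := exists_common_past hess v
    obtain ⟨w, hvw⟩ := (hess v).2
    have le_of_mem : ∀ m ∈ 𝒢.S v, ∀ n ∈ 𝒢.S v, n ≤ m := fun m hm n hn => by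
      by_contra! hlt
      obtain ⟨x, hx, hxz, -, hxm⟩ := hz m hm w hvw
      obtain ⟨y, hy, hyz, hyv, -⟩ := hz n hn w hvw
      refine ne_of_adj hvw ?_
      rw [← hxm, ← hyv m (by omega) (by omega), future_unique hx hy hxz hyz]
    exact fun m hm n hn => (le_of_mem n hn m hm).antisymm (le_of_mem m hm n hn)

theorem BlockStep.snd_eq {a b : V × ℤ} {n : ℕ} (h : 𝒢.BlockStep a b) (hn : 𝒢.S a.1 = {n}) :
    b.2 = a.2 + n := by
  obtain ⟨-, m, hm, hb⟩ := h
  rw [hn] at hm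
  exact hm ▸ hb

theorem biUnique_blockStep (hG : Relator.BiUnique 𝒢.graph.Adj)
    (hS : ∀ v, (𝒢.S v).Subsingleton) : Relator.BiUnique 𝒢.BlockStep := by
  constructor
  · rintro ⟨u, i⟩ ⟨v, j⟩ ⟨w, k⟩ ⟨huw, m, hm, rfl : k = i + m⟩ ⟨hvw, n, hn, hk : i + m = j + n⟩
    obtain rfl := hG.1 huw hvw
    obtain rfl := hS _ hm hn
    rw [add_right_cancel hk]
  · rintro ⟨u, i⟩ ⟨v, j⟩ ⟨w, k⟩ ⟨huv, m, hm, rfl : j = i + m⟩ ⟨huw, n, hn, rfl : k = i + n⟩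
    obtain rfl := hG.2 huv huw
    obtain rfl := hS _ hm hn
    rfl

theorem exists_isBlockDecomposition_zero {x : ℤ → V} (hx : x ∈ 𝒢.blockStrings) :
    ∃ f, 𝒢.IsBlockDecomposition x f ∧ (f 0).2 ≤ 0 ∧ 0 < (f 1).2 := by
  obtain ⟨f, hf⟩ := mem_blockStrings_iff_exists_isBlockDecomposition.1 hx
  obtain ⟨i, hi, hi'⟩ := exists_mem_Ico_succ (strictMono_of_blockStep hf.step) 0
  exact ⟨_, hf.comp_add_left i, by simpa only [add_zero] using hi, hi'⟩

theorem IsBlockDecomposition.apply_zero_eq {x : ℤ → V} {f g : ℤ → V × ℤ}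
    (hf : 𝒢.IsBlockDecomposition x f) (hg : 𝒢.IsBlockDecomposition x g) (hf0 : (f 0).2 ≤ 0)
    (hf1 : 0 < (f 1).2) (hg0 : (g 0).2 ≤ 0) (hg1 : 0 < (g 1).2) : f 0 = g 0 := by
  obtain ⟨m, hm, hfm⟩ := hf.exists_isBlock 0
  obtain ⟨n, hn, hgn⟩ := hg.exists_isBlock 0
  have hsnd := (hfm.eq_of_mem hgn hf0 (hm ▸ hf1) hg0 (hn ▸ hg1)).1
  exact Prod.ext (by rw [← hf.apply_start, hsnd, hg.apply_start]) hsnd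

theorem encard_blockStrings_eq_sum [Fintype V] (hess : 𝒢.graph.IsEssential)
    (hG : Relator.RightUnique 𝒢.graph.Adj) {s : V → ℕ} (hs : ∀ v, 𝒢.S v = {s v}) :
    𝒢.blockStrings.encard = (∑ v, s v : ℕ) := by
  have hstep := biUnique_blockStep (biUnique_adj_of_rightUnique hess hG)
    fun v => hs v ▸ Set.subsingleton_singleton
  choose f hf0 hf using fun p : Σ v, Fin (s v) => exists_blockStep_chain hess (p.1, -(p.2 : ℤ))
  choose x hx using fun p => exists_isBlockDecomposition (hf p)
  have hinj : Function.Injective x := fun p p' h => by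
    have straddle : ∀ p, (f p 0).2 ≤ 0 ∧ 0 < (f p 1).2 := fun p => by
      have h1 : (f p 1).2 = (f p 0).2 + s (f p 0).1 := (hf p 0).snd_eq (hs _)
      rw [h1, hf0]
      dsimp only
      omega
    have h0 := (hx p).apply_zero_eq (h ▸ hx p') (straddle p).1 (straddle p).2 (straddle p').1
      (straddle p').2
    obtain ⟨v, i⟩ := p
    obtain ⟨w, j⟩ := p'
    simp only [hf0, Prod.mk.injEq, neg_inj, Nat.cast_inj] at h0
    obtain ⟨rfl, hij⟩ := h0
    rw [Fin.ext hij]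
  have hrange : Set.range x = 𝒢.blockStrings := by
    refine Set.Subset.antisymm (Set.range_subset_iff.2 fun p =>
      mem_blockStrings_iff_exists_isBlockDecomposition.2 ⟨f p, hx p⟩) fun y hy => ?_
    obtain ⟨g, hg, hg0, hg1⟩ := exists_isBlockDecomposition_zero hy
    have hlen : (g 1).2 = (g 0).2 + s (g 0).1 := (hg.step 0).snd_eq (hs _)
    let p : Σ v, Fin (s v) := ⟨(g 0).1, (-(g 0).2).toNat, by omega⟩
    have hp : f p 0 = g 0 := (hf0 p).trans (Prod.ext rfl (by simp only [p]; omega))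
    exact ⟨p, (hx p).unique (int_chain_eq_of_biUnique hstep (hf p) hg.step hp ▸ hg)⟩
  rw [← hrange, ← Set.image_univ, hinj.encard_image, Set.encard_univ,
    ENat.card_eq_coe_fintype_card, Fintype.card_sigma]
  simp only [Fintype.card_fin]

theorem encard_blockStrings_lt_iff [Fintype V] (hess : 𝒢.graph.IsEssential) {q : ℕ} :
    𝒢.blockStrings.encard < q ↔
      Relator.RightUnique 𝒢.graph.Adj ∧ ∃ s : V → ℕ, (∀ v, 𝒢.S v = {s v}) ∧ ∑ v, s v < q := by
  constructor
  · intro hlt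
    obtain ⟨hG, hS⟩ := rightUnique_and_subsingleton_of_finite hess
      (Set.encard_lt_top_iff.1 (hlt.trans (ENat.natCast_lt_top q)))
    choose s hs using fun v => Set.exists_eq_singleton_iff_nonempty_subsingleton.2
      ⟨𝒢.nonempty v, hS v⟩
    exact ⟨hG, s, hs, by exact_mod_cast encard_blockStrings_eq_sum hess hG hs ▸ hlt⟩
  · rintro ⟨hG, s, hs, hlt⟩
    rw [encard_blockStrings_eq_sum hess hG hs]
    exact_mod_cast hlt

theorem exists_conjugate_option [Fintype V] [TopologicalSpace V] [DiscreteTopology V]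
    [TopologicalSpace (Option V)] [DiscreteTopology (Option V)] (hess : 𝒢.graph.IsEssential)
    (hcard : Fintype.card V < 𝒢.blockStrings.encard) :
    ∃ ℋ : SetEquippedGraph (Option V), ℋ.graph.IsEssential ∧
      SubshiftConjugate 𝒢.sgraphShift ℋ.sgraphShift := by
  by_cases hv : ∃ v, ∃ n ∈ 𝒢.S v, n ≠ 1
  · obtain ⟨v, hv⟩ := hv
    exact ⟨𝒢.splitHead v hv, splitHead_isEssential hess, splitHead_conjugate⟩
  push Not at hv
  have hS : ∀ v, 𝒢.S v = {1} := fun v => (𝒢.nonempty v).subset_singleton_iff.1 (hv v)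
  have hG : ¬ Relator.RightUnique 𝒢.graph.Adj := fun hG => by
    refine hcard.ne' ?_
    simp [encard_blockStrings_eq_sum hess hG (s := fun _ => 1) hS]
  simp only [Relator.RightUnique, not_forall] at hG
  obtain ⟨v, a, b, hva, hvb, hab⟩ := hG
  exact ⟨𝒢.splitOut v a, splitOut_isEssential hess hvb (Ne.symm hab),
    splitOut_conjugate (hS v) hva⟩

theorem encard_blockStrings_eq_of_conjugate {W : Type*} [TopologicalSpace V] [T1Space V]
    [TopologicalSpace W] [T1Space W] {ℋ : SetEquippedGraph W}
    (h : SubshiftConjugate 𝒢.sgraphShift ℋ.sgraphShift) :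
    𝒢.blockStrings.encard = ℋ.blockStrings.encard := by
  rw [← encard_carrier_sgraphShift, h.encard_eq, encard_carrier_sgraphShift]

theorem exists_conjugate_fin {q : ℕ} (d : ℕ) : ∀ {V : Type*} [Fintype V] [TopologicalSpace V]
    [DiscreteTopology V] {𝒢 : SetEquippedGraph V}, Fintype.card V + d = q →
    𝒢.graph.IsEssential → q ≤ 𝒢.blockStrings.encard →
    ∃ ℋ : SetEquippedGraph (Fin q), ℋ.graph.IsEssential ∧
      SubshiftConjugate 𝒢.sgraphShift ℋ.sgraphShift := by
  induction d with
  | zero =>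
    intro V _ _ _ 𝒢 hq hess _
    let e : Fin q ≃ V := (Fintype.equivFinOfCardEq hq).symm
    exact ⟨𝒢.relabel e, 𝒢.relabel_isEssential e hess, 𝒢.relabel_conjugate e⟩
  | succ d ih =>
    intro V _ _ _ 𝒢 hq hess hencard
    let _ : TopologicalSpace (Option V) := ⊥
    have : DiscreteTopology (Option V) := ⟨rfl⟩
    have hcard : (Fintype.card V : ℕ∞) < q := by exact_mod_cast (by omega)
    obtain ⟨𝒢', hess', hconj'⟩ := exists_conjugate_option hess (hcard.trans_le hencard)
    rw [encard_blockStrings_eq_of_conjugate hconj'] at hencard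
    obtain ⟨ℋ, hℋ, hconj⟩ := ih (by rw [Fintype.card_option]; omega) hess' hencard
    exact ⟨ℋ, hℋ, hconj'.trans hconj⟩

theorem exists_conjugate_fin_iff [Fintype V] [TopologicalSpace V] [DiscreteTopology V] {q : ℕ}
    (hV : Fintype.card V ≤ q) (hess : 𝒢.graph.IsEssential) :
    (∃ ℋ : SetEquippedGraph (Fin q), ℋ.graph.IsEssential ∧
      SubshiftConjugate 𝒢.sgraphShift ℋ.sgraphShift) ↔ q ≤ 𝒢.blockStrings.encard := by
  refine ⟨fun ⟨ℋ, hℋ, hconj⟩ => ?_,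
    exists_conjugate_fin (q - Fintype.card V) (Nat.add_sub_of_le hV) hess⟩
  rw [encard_blockStrings_eq_of_conjugate hconj]
  simpa only [Fintype.card_fin] using card_le_encard_blockStrings hℋ

end SetEquippedGraph

theorem mainTheorem12_general {V : Type*} [Fintype V] [TopologicalSpace V] [DiscreteTopology V]
    {q : ℕ} (hV : Fintype.card V ≤ q) {𝒢 : SetEquippedGraph V} (hess : 𝒢.graph.IsEssential) :
    (∃ ℋ : SetEquippedGraph (Fin q), ℋ.graph.IsEssential ∧
      SubshiftConjugate 𝒢.sgraphShift ℋ.sgraphShift) ↔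
    ¬ (Relator.RightUnique 𝒢.graph.Adj ∧
      ∃ s : V → ℕ, (∀ v, 𝒢.S v = {s v}) ∧ ∑ v, s v < q) := by
  rw [SetEquippedGraph.exists_conjugate_fin_iff hV hess, ← not_lt,
    SetEquippedGraph.encard_blockStrings_lt_iff hess]

theorem mainTheorem12 {V : Type*} [Fintype V] [TopologicalSpace V] [DiscreteTopology V]
    (p q : ℕ) (hp : 0 < p) (hpq : p < q) (hV : Fintype.card V = p)
    (𝒢 : SetEquippedGraph V) (hess : 𝒢.graph.IsEssential) (hirr : 𝒢.graph.IsIrreducible) :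
    ((𝒢.graph.IsDirectedCycle ∧ ∃ s : V → ℕ, (∀ v, 𝒢.S v = {s v}) ∧ ∑ v, s v < q) →
      ¬ ∃ ℋ : SetEquippedGraph (Fin q), ℋ.graph.IsEssential ∧
        SubshiftConjugate 𝒢.sgraphShift ℋ.sgraphShift) ∧
    (¬ (𝒢.graph.IsDirectedCycle ∧ ∃ s : V → ℕ, (∀ v, 𝒢.S v = {s v}) ∧ ∑ v, s v < q) →
      ∃ ℋ : SetEquippedGraph (Fin q), ℋ.graph.IsEssential ∧
        SubshiftConjugate 𝒢.sgraphShift ℋ.sgraphShift) := by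
  rw [isDirectedCycle_iff_rightUnique hess hirr, mainTheorem12_general (hV.trans_le hpq.le) hess]
  exact ⟨not_not_intro, id⟩
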